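/- Let $k$ be an algebraically closed field of characteristic $0$, and let $n \ge 1$ and $d \ge 2$ be integers. Let $\operatorname{End}^n_d$ denote the set of degree-$d$ endomorphisms of $\mathbb{P}^n$ over $k$, that is, of tuples $f = (f_0 : \dots : f_n)$, up to a common nonzero scalar, of homogeneous forms $f_i \in k[x_0, \dots, x_n]$ of degree $d$ with no common zero in $\mathbb{P}^n$. A point $P \in \mathbb{P}^n$ is a critical point of $f$ if the Jacobian determinant $\det(\partial f_i/\partial x_j)$ vanishes at $P$. For $s \ge 1$ put \[ Y_s = \{ f \in \operatorname{End}^n_d : \text{there is a critical point } P \text{ of } f \text{ with } f^s(P) = P \}, \] where $f^s$ is the $s$-th iterate of $f$; i.e. $Y_s$ is the set of $f$ with a critical point of period dividing $s$. Then for each pair of distinct prime numbers $p$ and $q$ exceeding $n$, the sets $Y_p$ and $Y_q$ are distinct subsets of $\operatorname{End}^n_d$. -/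

import Mathlib

open scoped LinearAlgebra.Projectivization

noncomputable section

namespace ProjEnd

variable (k : Type*) [Field k]

/-- Projective `n`-space over `k`: lines through the origin in `k ^ (n + 1)`. -/
abbrev Proj (n : ℕ) : Type _ := ℙ k (Fin (n + 1) → k)

/-- The vector space of `(n + 1)`-tuples of forms of degree `d` in `n + 1` variables. -/
abbrev FormTuple (n d : ℕ) : Type _ :=
  Fin (n + 1) → MvPolynomial.homogeneousSubmodule (Fin (n + 1)) k d

/-- The projective space of nonzero `(n + 1)`-tuples `(f₀ : … : fₙ)` of degree-`d` forms,
up to a common scalar. -/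
abbrev BarEnd (n d : ℕ) : Type _ := ℙ k (FormTuple k n d)

variable {k} {n d : ℕ}

/-- Evaluation of a tuple of forms at a vector. -/
def evalTuple (F : FormTuple k n d) (x : Fin (n + 1) → k) : Fin (n + 1) → k :=
  fun i => MvPolynomial.eval x (F i : MvPolynomial (Fin (n + 1)) k)

/-- The Jacobian determinant `det (∂ Fᵢ / ∂ xⱼ)`. -/
def jacobianDet (F : FormTuple k n d) : MvPolynomial (Fin (n + 1)) k :=
  Matrix.det (Matrix.of fun i j : Fin (n + 1) =>
    MvPolynomial.pderiv j (F i : MvPolynomial (Fin (n + 1)) k))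

/-- The forms `F₀, …, Fₙ` have no common zero other than the origin. -/
def NoCommonZero (F : FormTuple k n d) : Prop :=
  ∀ x : Fin (n + 1) → k, x ≠ 0 → evalTuple F x ≠ 0

lemma eval_smul_of_isHomogeneous {m : ℕ} {φ : MvPolynomial (Fin (n + 1)) k}
    (h : φ.IsHomogeneous m) (a : k) (x : Fin (n + 1) → k) :
    MvPolynomial.eval (a • x) φ = a ^ m * MvPolynomial.eval x φ := by
  rw [MvPolynomial.eval_eq, MvPolynomial.eval_eq, Finset.mul_sum]
  refine Finset.sum_congr rfl fun e he => ?_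
  have hdeg : ∑ i ∈ e.support, e i = m := by
    have := h (MvPolynomial.mem_support_iff.1 he)
    rw [← this, Finsupp.weight_apply]
    simp [Finsupp.sum]
  simp only [Pi.smul_apply, smul_eq_mul, mul_pow, Finset.prod_mul_distrib,
    Finset.prod_pow_eq_pow_sum, hdeg]
  ring

lemma evalTuple_smul_smul (a b : k) (F : FormTuple k n d) (x : Fin (n + 1) → k) :
    evalTuple (a • F) (b • x) = (a * b ^ d) • evalTuple F x := by
  funext i
  have h := eval_smul_of_isHomogeneous
    ((MvPolynomial.mem_homogeneousSubmodule _ _).1 (F i).2) b x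
  simp [evalTuple, h, mul_assoc]

lemma eval_jacobianDet_smul_smul (a b : k) (F : FormTuple k n d) (x : Fin (n + 1) → k) :
    MvPolynomial.eval (b • x) (jacobianDet (a • F)) =
      (a * b ^ (d - 1)) ^ (n + 1) * MvPolynomial.eval x (jacobianDet F) := by
  simp only [jacobianDet, RingHom.map_det]
  have h : (MvPolynomial.eval (b • x)).mapMatrix (Matrix.of fun i j : Fin (n + 1) =>
        MvPolynomial.pderiv j ((a • F) i : MvPolynomial (Fin (n + 1)) k)) =
      (a * b ^ (d - 1)) • (MvPolynomial.eval x).mapMatrix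
        (Matrix.of fun i j : Fin (n + 1) =>
          MvPolynomial.pderiv j (F i : MvPolynomial (Fin (n + 1)) k)) := by
    ext i j
    have h := eval_smul_of_isHomogeneous
      (((MvPolynomial.mem_homogeneousSubmodule _ _).1 (F i).2).pderiv (i := j)) b x
    simp [h, mul_assoc]
  rw [h, Matrix.det_smul, Fintype.card_fin]

lemma noCommonZero_smul {a : k} (ha : a ≠ 0) {F : FormTuple k n d} (hF : NoCommonZero F) :
    NoCommonZero (a • F) := by
  intro x hx
  have h := evalTuple_smul_smul a 1 F x
  simp only [one_smul, one_pow, mul_one] at h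
  rw [h]
  exact smul_ne_zero ha (hF x hx)

variable (k n d)

/-- `End^n_d`: the elements of the projective space of tuples that define a morphism of
degree `d`, i.e. those without a common zero in projective space. -/
abbrev EndP : Type _ := {f : BarEnd k n d // NoCommonZero f.rep}

variable {k n d}

/-- The self-map of projective space induced by `f`, namely
`P ↦ (f₀(P) : … : fₙ(P))`. -/
def EndP.toMap (f : EndP k n d) (P : Proj k n) : Proj k n :=
  Projectivization.mk k (evalTuple f.1.rep P.rep) (f.2 P.rep P.rep_nonzero)

/-- `P` is a critical point of `f`: it lies on the zero locus of the Jacobian determinant. -/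
def EndP.IsCritical (f : EndP k n d) (P : Proj k n) : Prop :=
  MvPolynomial.eval P.rep (jacobianDet f.1.rep) = 0

/-- Whether a class `(F₀ : … : Fₙ)` lies in `End^n_d` may be tested on any representative. -/
lemma noCommonZero_rep_iff (F : FormTuple k n d) (hF : F ≠ 0) :
    NoCommonZero (Projectivization.mk k F hF).rep ↔ NoCommonZero F := by
  obtain ⟨a, ha⟩ := Projectivization.exists_smul_eq_mk_rep k F hF
  rw [← ha]
  refine ⟨fun h => ?_, fun h => noCommonZero_smul a.ne_zero h⟩
  have := noCommonZero_smul (a := ((a⁻¹ : kˣ) : k)) (a⁻¹).ne_zero h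
  rw [← Units.smul_def, inv_smul_smul] at this
  exact this

/-- The induced map may be computed with any representatives. -/
lemma EndP.toMap_mk (f : EndP k n d) (F : FormTuple k n d) (hF : F ≠ 0)
    (hf : f.1 = Projectivization.mk k F hF) (x : Fin (n + 1) → k) (hx : x ≠ 0)
    (hFx : evalTuple F x ≠ 0) :
    f.toMap (Projectivization.mk k x hx) = Projectivization.mk k (evalTuple F x) hFx := by
  obtain ⟨a, ha⟩ := Projectivization.exists_smul_eq_mk_rep k F hF
  obtain ⟨b, hb⟩ := Projectivization.exists_smul_eq_mk_rep k x hx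
  unfold EndP.toMap
  rw [Projectivization.mk_eq_mk_iff']
  refine ⟨(a : k) * (b : k) ^ d, ?_⟩
  rw [hf, ← ha, ← hb, Units.smul_def, Units.smul_def, evalTuple_smul_smul]

/-- Criticality may be tested on any representatives. -/
lemma EndP.isCritical_mk (f : EndP k n d) (F : FormTuple k n d) (hF : F ≠ 0)
    (hf : f.1 = Projectivization.mk k F hF) (x : Fin (n + 1) → k) (hx : x ≠ 0) :
    f.IsCritical (Projectivization.mk k x hx) ↔
      MvPolynomial.eval x (jacobianDet F) = 0 := by
  obtain ⟨a, ha⟩ := Projectivization.exists_smul_eq_mk_rep k F hF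
  obtain ⟨b, hb⟩ := Projectivization.exists_smul_eq_mk_rep k x hx
  unfold EndP.IsCritical
  rw [hf, ← ha, ← hb, Units.smul_def, Units.smul_def, eval_jacobianDet_smul_smul]
  simp

variable (k n d)

/-- The set of `f` in `End^n_d` that have a critical point of period dividing `s`. -/
def Y (s : ℕ) : Set (EndP k n d) :=
  {f | ∃ P : Proj k n, f.IsCritical P ∧ Function.IsPeriodicPt f.toMap s P}

end ProjEnd

end

namespace ProjEnd

open MvPolynomial

/-! A binary form of degree `n` up to scalar is an effective divisor of degree `n` on the projective
line, so the `n`-th symmetric power of a degree-`d` map φ of the line is a degree-`d` endomorphism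
of projective `n`-space. Take φ = (wᵈ : zᵈ + c wᵈ), whose only critical points are 0 and ∞, with ∞ ↦
0, and choose `c` so that ∞ has exact period `p` (`exists_bicritical_periodic`,
`minimalPeriod_bicriticalMap_none`). Its symmetric power lies in `Y p` but not in `Y q`.

The divisor n·∞ is critical and is fixed by the `p`-th iterate. Conversely, let D be fixed by the
`q`-th iterate. The support of D has at most `n` points and is permuted by φ^q, so φ is injective on
it. As `p` and `q` are coprime, 0 and ∞ have period `p > n` under φ^q, so neither lies in the
support. Away from 0 and ∞ the fibres of φ are orbits under rotation by `d`-th roots of unity; hence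
the form of D is coprime to its nontrivial rotations, and the Jacobian is invertible there
(`IsSymPow.det_jacobianAt_ne_zero`). -/

/-- The binary form `∑ xᵢ aⁱ bⁿ⁻ⁱ` with coefficient vector `x`, as a function of `(a, b)`. -/
def binaryForm {R : Type*} [CommSemiring R] {n : ℕ} (x : Fin (n + 1) → R) (a b : R) : R :=
  ∑ i, x i * (a ^ (i : ℕ) * b ^ (n - i))

/-! ### Binary forms and their dehomogenizations -/

section BinaryForm

variable {k : Type*} [Field k] {n : ℕ}

lemma binaryForm_smul (t : k) (x : Fin (n + 1) → k) (a b : k) :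
    binaryForm (t • x) a b = t * binaryForm x a b := by
  simp [binaryForm, Finset.mul_sum, mul_assoc]

lemma binaryForm_mul_mul (t : k) (x : Fin (n + 1) → k) (a b : k) :
    binaryForm x (t * a) (t * b) = t ^ n * binaryForm x a b := by
  simp only [binaryForm, Finset.mul_sum]
  refine Finset.sum_congr rfl fun i _ => ?_
  have h : t ^ n = t ^ (i : ℕ) * t ^ (n - i) := by rw [← pow_add]; congr 1; omega
  rw [h]; ring

/-- The dehomogenization of the binary form with coefficient vector `x`. -/
noncomputable def dehom (x : Fin (n + 1) → k) : Polynomial k :=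
  ∑ i, Polynomial.C (x i) * Polynomial.X ^ (i : ℕ)

lemma eval_dehom (x : Fin (n + 1) → k) (z : k) : (dehom x).eval z = binaryForm x z 1 := by
  simp [dehom, binaryForm, Polynomial.eval_finsetSum]

lemma coeff_dehom (x : Fin (n + 1) → k) (i : Fin (n + 1)) : (dehom x).coeff i = x i := by
  simp only [dehom, Polynomial.finsetSum_coeff, Polynomial.coeff_C_mul, Polynomial.coeff_X_pow]
  simp [Fin.val_inj]

lemma natDegree_dehom_le (x : Fin (n + 1) → k) : (dehom x).natDegree ≤ n := by
  refine Polynomial.natDegree_sum_le_of_forall_le _ _ fun i _ => ?_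
  exact (Polynomial.natDegree_C_mul_X_pow_le _ _).trans (by omega)

lemma dehom_eq_zero_iff (x : Fin (n + 1) → k) : dehom x = 0 ↔ x = 0 := by
  refine ⟨fun h => ?_, fun h => by simp [dehom, h]⟩
  funext i
  rw [← coeff_dehom x, h]; simp

lemma binaryForm_one_zero (x : Fin (n + 1) → k) : binaryForm x 1 0 = x (Fin.last n) := by
  rw [binaryForm, Finset.sum_eq_single (Fin.last n)]
  · simp
  · intro i _ hi
    have : n - (i : ℕ) ≠ 0 := by
      have := Fin.val_lt_last hi
      omega
    simp [this]
  · simp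

lemma eq_of_binaryForm_eq [Infinite k] {x y : Fin (n + 1) → k}
    (h : ∀ a b, binaryForm x a b = binaryForm y a b) : x = y := by
  have : dehom x = dehom y := Polynomial.funext fun z => by
    rw [eval_dehom, eval_dehom, h]
  funext i
  rw [← coeff_dehom x, this, coeff_dehom]

lemma eq_zero_of_binaryForm_eq_zero [Infinite k] {x : Fin (n + 1) → k}
    (h : ∀ a b, binaryForm x a b = 0) : x = 0 :=
  eq_of_binaryForm_eq fun a b => by rw [h]; simp [binaryForm]

end BinaryForm

/-! ### Construction of the symmetric power as a norm -/

section NormForms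

variable {k : Type*} [Field k]

lemma isHomogeneous_X_mul_C {σ : Type*} (i : σ) (a : k) :
    (X i * C a : MvPolynomial σ k).IsHomogeneous 1 :=
  (isHomogeneous_X k i).mul (isHomogeneous_C σ a)

/-- The product of the `d` rotations of the generic binary form is a binary form in the
`d`-th powers of the variables. -/
lemma exists_normForms [Infinite k] {d : ℕ} (hd : 0 < d) {ζ : k} (hζ : IsPrimitiveRoot ζ d)
    (n : ℕ) :
    ∃ G : Fin (n + 1) → MvPolynomial (Fin (n + 1)) k, (∀ m, (G m).IsHomogeneous d) ∧
      ∀ z w : k, binaryForm G (C (z ^ d)) (C (w ^ d)) =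
        ∏ j : Fin d, binaryForm X (C (ζ ^ (j : ℕ) * z)) (C w) := by
  classical
  -- `g` picks one monomial from each of the `d` factors; `wt g` is the resulting exponent of `z`,
  -- and `G s` collects the coefficient of `z ^ s`.
  let wt : (Fin d → Fin (n + 1)) → ℕ := fun g => ∑ j, (g j : ℕ)
  let T : (Fin d → Fin (n + 1)) → MvPolynomial (Fin (n + 1)) k := fun g =>
    ∏ j : Fin d, (X (g j) * C ((ζ ^ (j : ℕ)) ^ (g j : ℕ)))
  let G : ℕ → MvPolynomial (Fin (n + 1)) k := fun s => ∑ g with wt g = s, T g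
  have hwt : ∀ g, wt g ∈ Finset.range (n * d + 1) := fun g => by
    have : wt g ≤ ∑ _j : Fin d, n := Finset.sum_le_sum fun j _ => by omega
    simp at this
    simp only [Finset.mem_range]; nlinarith
  have hG : ∀ z w : k, ∏ j : Fin d, binaryForm X (C (ζ ^ (j : ℕ) * z)) (C w) =
      ∑ s ∈ Finset.range (n * d + 1), G s * C (z ^ s * w ^ (n * d - s)) := by
    intro z w
    have h1 : ∏ j : Fin d, binaryForm X (C (ζ ^ (j : ℕ) * z)) (C w) =
        ∑ g : Fin d → Fin (n + 1), T g * C (z ^ wt g * w ^ (n * d - wt g)) := by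
      simp only [binaryForm]
      rw [Finset.prod_univ_sum, Fintype.piFinset_univ]
      refine Finset.sum_congr rfl fun g _ => ?_
      have h2 : n * d - wt g = ∑ j : Fin d, (n - (g j : ℕ)) := by
        have : ∑ j : Fin d, (n - (g j : ℕ)) + wt g = n * d := by
          rw [← Finset.sum_add_distrib, Finset.sum_congr rfl
            (fun j _ => Nat.sub_add_cancel (Nat.lt_succ_iff.1 (g j).2))]
          simp [mul_comm]
        omega
      rw [h2, ← Finset.prod_pow_eq_pow_sum, ← Finset.prod_pow_eq_pow_sum, map_mul, map_prod,
        map_prod, ← Finset.prod_mul_distrib, ← Finset.prod_mul_distrib]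
      refine Finset.prod_congr rfl fun j _ => ?_
      simp only [map_mul, map_pow, mul_pow]
      ring
    rw [h1, ← Finset.sum_fiberwise_of_maps_to (fun g _ => hwt g)]
    refine Finset.sum_congr rfl fun s _ => ?_
    rw [Finset.sum_mul]
    refine Finset.sum_congr rfl fun g hg => ?_
    rw [(Finset.mem_filter.1 hg).2]
  -- Replacing `z` by `ζ * z` permutes the factors cyclically, so only powers of `z ^ d` can
  -- survive.
  have hrot : ∀ z : k, ∏ j : Fin d, binaryForm (n := n) X (C (ζ ^ (j : ℕ) * (ζ * z))) (C 1) =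
      ∏ j : Fin d, binaryForm X (C (ζ ^ (j : ℕ) * z)) (C 1) := by
    intro z
    obtain ⟨e, rfl⟩ : ∃ e, d = e + 1 := ⟨d - 1, by omega⟩
    rw [Fin.prod_univ_castSucc, Fin.prod_univ_succ, mul_comm]
    congr 1
    · simp only [Fin.val_last, Fin.val_zero, pow_zero, one_mul, ← mul_assoc, ← pow_succ,
        hζ.pow_eq_one]
    · refine Finset.prod_congr rfl fun j _ => ?_
      simp only [Fin.val_castSucc, Fin.val_succ, ← mul_assoc, ← pow_succ]
  have hzero : ∀ s, s < n * d + 1 → ¬ d ∣ s → G s = 0 := by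
    -- `Q` is the difference of the products at `ζ * z` and `z`, with `w = 1`. It vanishes at every
    -- constant, hence identically, which kills `G s` when `ζ ^ s ≠ 1`.
    let Q : Polynomial (MvPolynomial (Fin (n + 1)) k) :=
      ∑ s ∈ Finset.range (n * d + 1), Polynomial.C (G s * C (ζ ^ s - 1)) * Polynomial.X ^ s
    have hQ : Q = 0 := by
      refine Polynomial.eq_zero_of_infinite_isRoot Q ?_
      refine Set.Infinite.mono (s := Set.range (C : k → MvPolynomial (Fin (n + 1)) k)) ?_
        (Set.infinite_range_of_injective (C_injective _ _))
      rintro _ ⟨z, rfl⟩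
      have h := hrot z
      rw [hG, hG, ← sub_eq_zero, ← Finset.sum_sub_distrib] at h
      simp only [Set.mem_ofPred_eq, Polynomial.IsRoot, Q, Polynomial.eval_finsetSum]
      rw [← h]
      refine Finset.sum_congr rfl fun s _ => ?_
      simp [mul_pow]
      ring
    intro s hs hds
    have h : Q.coeff s = G s * C (ζ ^ s - 1) := by
      simp only [Q, Polynomial.finsetSum_coeff, Polynomial.coeff_C_mul, Polynomial.coeff_X_pow]
      simp [hs]
    rw [hQ, Polynomial.coeff_zero] at h
    refine (mul_eq_zero.1 h.symm).resolve_right fun h0 => hds ?_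
    rw [C_eq_zero, sub_eq_zero] at h0
    exact hζ.dvd_of_pow_eq_one s h0
  refine ⟨fun m => G (d * m), fun m => ?_, fun z w => ?_⟩
  · refine IsHomogeneous.sum _ _ _ fun g _ => ?_
    have h := IsHomogeneous.prod Finset.univ _ (fun _ : Fin d => 1) fun j _ =>
      isHomogeneous_X_mul_C (g j) ((ζ ^ (j : ℕ)) ^ (g j : ℕ))
    rwa [Finset.sum_const, Finset.card_univ, Fintype.card_fin, smul_eq_mul, mul_one] at h
  · rw [hG, binaryForm]
    symm
    rw [Finset.sum_fin_eq_sum_range]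
    refine Finset.sum_of_injOn (fun m => d * m) ?_ ?_ ?_ ?_ |>.symm
    · intro a _ b _ h
      exact Nat.eq_of_mul_eq_mul_left hd h
    · intro m hm
      simp only [Finset.coe_range, Set.mem_Iio] at hm ⊢
      have := Nat.mul_le_mul_left d (Nat.lt_succ_iff.1 hm)
      rw [mul_comm n d]; omega
    · intro s hs hs'
      rw [hzero s (Finset.mem_range.1 hs), zero_mul]
      rintro ⟨m, rfl⟩
      refine hs' ⟨m, ?_, rfl⟩
      have := Finset.mem_range.1 hs
      simp only [Finset.coe_range, Set.mem_Iio]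
      have : d * m ≤ d * n := by rw [mul_comm d n]; omega
      have := Nat.le_of_mul_le_mul_left this hd
      omega
    · intro m hm
      have hm := Finset.mem_range.1 hm
      have : n * d - d * m = d * (n - m) := by rw [Nat.mul_sub, mul_comm n d]
      simp only [hm, dif_pos, this, pow_mul, map_mul, map_pow]

/-- Expansion of a product of powers of two linear forms as a binary form. -/
lemma exists_binaryForm_eq_substitution (c : k) {n m : ℕ} (hm : m ≤ n) :
    ∃ y : Fin (n + 1) → k, ∀ a b, binaryForm y a b = (b - c * a) ^ m * a ^ (n - m) := by
  refine ⟨fun i => (m.choose (n - i) : k) * (-c) ^ (m - (n - i)), fun a b => ?_⟩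
  have h : (b - c * a) ^ m * a ^ (n - m) = ∑ t ∈ Finset.range (n + 1),
      (m.choose t : k) * (-c) ^ (m - t) * (a ^ (n - t) * b ^ t) := by
    rw [sub_eq_add_neg, add_pow, Finset.sum_mul]
    refine Finset.sum_subset_zero_on_sdiff (by simpa using hm) ?_ ?_
    · intro t ht
      have : m < t := by
        have := (Finset.mem_sdiff.1 ht).2
        simp at this; omega
      simp [Nat.choose_eq_zero_of_lt this]
    · intro t ht
      have ht : t ≤ m := by simpa [Nat.lt_succ_iff] using ht
      have h2 : a ^ (n - t) = a ^ (m - t) * a ^ (n - m) := by rw [← pow_add]; congr 1; omega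
      rw [h2, show -(c * a) = -c * a by ring, mul_pow]
      ring
  rw [h, ← Finset.sum_range_reflect, Finset.sum_range, binaryForm]
  refine Finset.sum_congr rfl fun i _ => ?_
  have h1 : n + 1 - 1 - (i : ℕ) = n - i := by omega
  have h2 : n - (n - (i : ℕ)) = i := by omega
  rw [h1, h2]

/-- The forms defining the `n`-th symmetric power of `(z : w) ↦ (wᵈ : zᵈ + c wᵈ)`. -/
lemma exists_symPowForms [Infinite k] {d : ℕ} (hd : 0 < d) {ζ : k} (hζ : IsPrimitiveRoot ζ d)
    (n : ℕ) (c : k) :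
    ∃ F : FormTuple k n d, ∀ z w : k,
      binaryForm (fun i => (F i : MvPolynomial (Fin (n + 1)) k))
        (C (w ^ d)) (C (z ^ d + c * w ^ d)) =
        ∏ j : Fin d, binaryForm X (C (ζ ^ (j : ℕ) * z)) (C w) := by
  obtain ⟨G, hG, hGprod⟩ := exists_normForms hd hζ n
  -- With `a = w ^ d` and `b = z ^ d + c * w ^ d`, the expression `(b - c * a) ^ m * a ^ (n - m)` is
  -- the monomial multiplying `G m`; `y m` re-expands it in `a` and `b`.
  choose y hy using fun m : Fin (n + 1) =>
    exists_binaryForm_eq_substitution c (Nat.lt_succ_iff.1 m.2)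
  refine ⟨fun i => ⟨∑ m, C (y m i) * G m, ?_⟩, fun z w => ?_⟩
  · rw [mem_homogeneousSubmodule]
    refine IsHomogeneous.sum _ _ _ fun m _ => ?_
    simpa using (isHomogeneous_C _ (y m i)).mul (hG m)
  · rw [← hGprod, binaryForm, binaryForm]
    simp only [Finset.sum_mul]
    rw [Finset.sum_comm]
    refine Finset.sum_congr rfl fun m _ => ?_
    have h := congrArg (C : k → MvPolynomial (Fin (n + 1)) k) (hy m (w ^ d) (z ^ d + c * w ^ d))
    rw [add_sub_cancel_right, binaryForm] at h
    simp only [← map_pow, ← map_mul] at h ⊢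
    rw [← h, map_sum, Finset.mul_sum]
    refine Finset.sum_congr rfl fun i _ => ?_
    simp only [map_mul]
    ring

end NormForms

end ProjEnd

/-! ### The one-parameter family on the line, and the choice of `c` -/

namespace ProjEnd

/-- The homogeneous lift `(z, w) ↦ (wᵈ, zᵈ + c wᵈ)` of a rational map whose only critical
points are `0` and `∞`. -/
def bicritical {R : Type*} [CommSemiring R] (d : ℕ) (c : R) (v : R × R) : R × R :=
  (v.2 ^ d, v.1 ^ d + c * v.2 ^ d)

section Param

variable {k : Type*} [Field k]

lemma map_iterate_bicritical {R S : Type*} [CommSemiring R] [CommSemiring S] (φ : R →+* S)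
    (d : ℕ) (c : R) (v : R × R) (s : ℕ) :
    Prod.map φ φ ((bicritical d c)^[s] v) = (bicritical d (φ c))^[s] (Prod.map φ φ v) := by
  refine Function.Semiconj.iterate_right (f := Prod.map φ φ) (fun v => ?_) s v
  simp [bicritical]

-- The term `X * v.2 ^ d` dominates `v.1 ^ d`. The weak inequality assumed on degrees lets an
-- induction start at `(0, 1)`, where both are 0.
open Polynomial in
lemma bicritical_X_monic {d : ℕ} {v : k[X] × k[X]} (h1 : v.1.natDegree ≤ v.2.natDegree)
    (h2 : v.2.Monic) :
    (bicritical d X v).1.natDegree < (bicritical d X v).2.natDegree ∧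
      (bicritical d X v).2.Monic := by
  have hm : (X * v.2 ^ d).Monic := monic_X.mul (h2.pow d)
  have hdeg : (X * v.2 ^ d).natDegree = d * v.2.natDegree + 1 := by
    rw [monic_X.natDegree_mul (h2.pow d), h2.natDegree_pow, natDegree_X, add_comm]
  have hlt : (v.1 ^ d).natDegree < (X * v.2 ^ d).natDegree := by
    rw [hdeg]
    exact Nat.lt_succ_of_le (natDegree_pow_le.trans (Nat.mul_le_mul_left d h1))
  have hlt' : (v.1 ^ d).degree < (X * v.2 ^ d).degree := degree_lt_degree hlt
  simp only [bicritical]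
  refine ⟨?_, hm.add_of_right hlt'⟩
  rw [natDegree_add_eq_right_of_degree_lt hlt', hdeg, h2.natDegree_pow]
  omega

open Polynomial in
/-- Some member of the family `(z : w) ↦ (wᵈ : zᵈ + c wᵈ)` has `∞` as a point of period
dividing `p`. -/
lemma exists_bicritical_periodic [IsAlgClosed k] {d : ℕ} (hd : 0 < d) {p : ℕ} (hp : 2 ≤ p) :
    ∃ c : k, ((bicritical d c)^[p] (1, 0)).2 = 0 := by
  -- The orbit of `(1, 0)` is `(0, 1)`, `(1, X)`, …, so the second coordinate is monic and
  -- nonconstant from the second iterate on: hence the shift by 2.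
  have key : ∀ s, ((bicritical d (X : k[X]))^[s + 2] (1, 0)).1.natDegree <
      ((bicritical d (X : k[X]))^[s + 2] (1, 0)).2.natDegree ∧
      ((bicritical d (X : k[X]))^[s + 2] (1, 0)).2.Monic := by
    intro s
    induction s with
    | zero =>
      rw [zero_add, Function.iterate_succ_apply', Function.iterate_one]
      refine bicritical_X_monic ?_ ?_ <;> simp [bicritical, hd.ne']
    | succ s ih =>
      rw [show s + 1 + 2 = (s + 2) + 1 by ring, Function.iterate_succ_apply']
      exact bicritical_X_monic ih.1.le ih.2
  obtain ⟨s, rfl⟩ : ∃ s, p = s + 2 := ⟨p - 2, by omega⟩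
  obtain ⟨h1, h2⟩ := key s
  obtain ⟨c, hc⟩ := IsAlgClosed.exists_root ((bicritical d (X : k[X]))^[s + 2] (1, 0)).2
    (fun h => by rw [natDegree_eq_of_degree_eq_some h] at h1; exact absurd h1 (Nat.not_lt_zero _))
  refine ⟨c, ?_⟩
  have := map_iterate_bicritical (evalRingHom c) d X (1, 0) (s + 2)
  simp only [coe_evalRingHom, eval_X, Prod.map_apply, eval_one, eval_zero] at this
  rw [← this]
  exact hc

end Param

/-! ### Dynamics and zero sets on `k ∪ {∞}` -/

section ProjectiveLine

variable {k : Type*} [Field k]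

/-- The standard homogeneous coordinates of a point of `k ∪ {∞}`. -/
def ptRep : Option k → k × k
  | none => (1, 0)
  | some z => (z, 1)

open Classical in
/-- The point of `k ∪ {∞}` with homogeneous coordinates `v`. -/
noncomputable def ptClass (v : k × k) : Option k := if v.2 = 0 then none else some (v.1 / v.2)

lemma ptClass_ptRep (o : Option k) : ptClass (ptRep o) = o := by
  cases o <;> simp [ptRep, ptClass]

lemma ptRep_ne_zero (o : Option k) : ptRep o ≠ 0 := by
  cases o <;> simp [ptRep]

lemma exists_smul_ptRep_ptClass {v : k × k} (hv : v ≠ 0) :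
    ∃ t : k, t ≠ 0 ∧ v = t • ptRep (ptClass v) := by
  obtain ⟨a, b⟩ := v
  by_cases hb : b = 0
  · subst hb
    refine ⟨a, fun h => hv (by simp [h]), by simp [ptClass, ptRep]⟩
  · exact ⟨b, hb, by simp [ptClass, ptRep, hb, mul_div_cancel₀]⟩

lemma ptClass_smul {t : k} (ht : t ≠ 0) (v : k × k) : ptClass (t • v) = ptClass v := by
  by_cases hv : v.2 = 0 <;> simp [ptClass, ht, hv, mul_div_mul_left]

lemma bicritical_smul (d : ℕ) (c t : k) (v : k × k) :
    bicritical d c (t • v) = t ^ d • bicritical d c v := by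
  ext <;> simp [bicritical, mul_pow]; ring

lemma bicritical_ne_zero {d : ℕ} (hd : 0 < d) (c : k) {v : k × k} (hv : v ≠ 0) :
    bicritical d c v ≠ 0 := by
  intro h
  have h1 := congrArg Prod.fst h
  have h2 := congrArg Prod.snd h
  simp only [bicritical, Prod.fst_zero, Prod.snd_zero] at h1 h2
  rw [h1, mul_zero, add_zero] at h2
  exact hv (Prod.ext (by simpa using pow_eq_zero_iff hd.ne' |>.1 h2)
    (by simpa using pow_eq_zero_iff hd.ne' |>.1 h1))

/-- The self-map of `k ∪ {∞}` induced by `bicritical d c`. -/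
noncomputable def bicriticalMap (d : ℕ) (c : k) (o : Option k) : Option k :=
  ptClass (bicritical d c (ptRep o))

lemma ptClass_bicritical (d : ℕ) (c : k) {v : k × k} (hv : v ≠ 0) :
    ptClass (bicritical d c v) = bicriticalMap d c (ptClass v) := by
  obtain ⟨t, ht, h⟩ := exists_smul_ptRep_ptClass hv
  conv_lhs => rw [h]
  rw [bicritical_smul, ptClass_smul (pow_ne_zero d ht), bicriticalMap]

lemma iterate_bicritical_ne_zero {d : ℕ} (hd : 0 < d) (c : k) {v : k × k} (hv : v ≠ 0) (s : ℕ) :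
    (bicritical d c)^[s] v ≠ 0 := by
  induction s with
  | zero => exact hv
  | succ s ih =>
    rw [Function.iterate_succ_apply']
    exact bicritical_ne_zero hd c ih

lemma ptClass_iterate_bicritical {d : ℕ} (hd : 0 < d) (c : k) {v : k × k} (hv : v ≠ 0) (s : ℕ) :
    ptClass ((bicritical d c)^[s] v) = (bicriticalMap d c)^[s] (ptClass v) := by
  induction s with
  | zero => rfl
  | succ s ih =>
    rw [Function.iterate_succ_apply', Function.iterate_succ_apply',
      ptClass_bicritical d c (iterate_bicritical_ne_zero hd c hv s), ih]

lemma bicriticalMap_none {d : ℕ} (hd : 0 < d) (c : k) : bicriticalMap d c none = some 0 := by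
  simp [bicriticalMap, bicritical, ptRep, ptClass, hd.ne']

/-- Since `p` is prime, it is enough that ∞ is not fixed, and it maps to 0. -/
lemma minimalPeriod_bicriticalMap_none {d : ℕ} (hd : 0 < d) {c : k} {p : ℕ} (hp : p.Prime)
    (hc : ((bicritical d c)^[p] (1, 0)).2 = 0) :
    Function.minimalPeriod (bicriticalMap d c) none = p := by
  have : Fact p.Prime := ⟨hp⟩
  refine Function.minimalPeriod_eq_prime ?_ ?_
  · have h := ptClass_iterate_bicritical hd c (v := (1, 0)) (by simp) p
    rw [ptClass, if_pos hc] at h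
    have h0 : ptClass ((1, 0) : k × k) = none := by simp [ptClass]
    rw [h0] at h
    exact h.symm
  · intro h
    have h' := h.eq
    rw [bicriticalMap_none hd] at h'
    exact absurd h' (by simp)

/-- The zero set in `k ∪ {∞}` of the binary form with coefficient vector `x`. -/
def zeroSet {n : ℕ} (x : Fin (n + 1) → k) : Set (Option k) :=
  {o | binaryForm x (ptRep o).1 (ptRep o).2 = 0}

lemma none_mem_zeroSet {n : ℕ} {x : Fin (n + 1) → k} :
    none ∈ zeroSet x ↔ x (Fin.last n) = 0 := by
  rw [← binaryForm_one_zero x]; rfl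

lemma some_mem_zeroSet {n : ℕ} {x : Fin (n + 1) → k} {z : k} :
    some z ∈ zeroSet x ↔ binaryForm x z 1 = 0 := Iff.rfl

lemma ptClass_mem_zeroSet {n : ℕ} {x : Fin (n + 1) → k} {v : k × k} (hv : v ≠ 0)
    (h : binaryForm x v.1 v.2 = 0) : ptClass v ∈ zeroSet x := by
  obtain ⟨t, ht, hvt⟩ := exists_smul_ptRep_ptClass hv
  rw [hvt, Prod.smul_fst, Prod.smul_snd, smul_eq_mul, smul_eq_mul, binaryForm_mul_mul] at h
  exact (mul_eq_zero.1 h).resolve_left (pow_ne_zero n ht)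

lemma zeroSet_smul {n : ℕ} {t : k} (ht : t ≠ 0) (x : Fin (n + 1) → k) :
    zeroSet (t • x) = zeroSet x := by
  ext o
  simp [zeroSet, binaryForm_smul, ht]

/-- A nonzero binary form of degree `n` has at most `n` zeros on the projective line. -/
lemma exists_finset_card_le_zeroSet {n : ℕ} {x : Fin (n + 1) → k} (hx : x ≠ 0) :
    ∃ s : Finset (Option k), (s : Set (Option k)) = zeroSet x ∧ s.card ≤ n := by
  classical
  have hP : dehom x ≠ 0 := fun h => hx ((dehom_eq_zero_iff x).1 h)
  have hcard : (dehom x).roots.toFinset.card ≤ (dehom x).natDegree :=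
    (Multiset.toFinset_card_le _).trans (Polynomial.card_roots' _)
  have hsome : ∀ z, z ∈ (dehom x).roots.toFinset ↔ some z ∈ zeroSet x := fun z => by
    rw [Multiset.mem_toFinset, Polynomial.mem_roots hP, Polynomial.IsRoot, eval_dehom,
      some_mem_zeroSet]
  by_cases h : none ∈ zeroSet x
  · refine ⟨Finset.insertNone (dehom x).roots.toFinset, ?_, ?_⟩
    · ext o
      cases o with
      | none => simp [h]
      | some z => simpa using hsome z
    -- A zero at ∞ kills the top coefficient; the degree drops below `n`, which leaves room for the
    -- extra point.
    · have hne : (dehom x).natDegree ≠ n := fun hn => by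
        rw [none_mem_zeroSet, ← coeff_dehom x, Fin.val_last] at h
        exact hP (Polynomial.leadingCoeff_eq_zero.1 ((congrArg _ hn).trans h))
      have := natDegree_dehom_le x
      rw [Finset.card_insertNone]
      omega
  · refine ⟨(dehom x).roots.toFinset.map Function.Embedding.some, ?_, ?_⟩
    · ext o
      cases o with
      | none => simpa using h
      | some z => simpa using hsome z
    · rw [Finset.card_map]
      exact hcard.trans (natDegree_dehom_le x)

end ProjectiveLine

end ProjEnd

/-! ### The Jacobian of the symmetric power -/

namespace ProjEnd

open MvPolynomial

lemma derivation_prod {R A ι : Type*} [CommSemiring R] [CommSemiring A] [Algebra R A]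
    [DecidableEq ι] (D : Derivation R A A) (s : Finset ι) (f : ι → A) :
    D (∏ i ∈ s, f i) = ∑ i ∈ s, D (f i) * ∏ l ∈ s.erase i, f l := by
  induction s using Finset.induction_on with
  | empty => simp
  | insert a s ha ih =>
    rw [Finset.prod_insert ha, D.leibniz, ih, Finset.sum_insert ha, Finset.erase_insert ha,
      smul_eq_mul, smul_eq_mul, Finset.mul_sum, add_comm, mul_comm (∏ i ∈ s, f i)]
    congr 1
    refine Finset.sum_congr rfl fun i hi => ?_
    have hia : a ≠ i := fun h => ha (h ▸ hi)
    rw [Finset.erase_insert_of_ne hia, Finset.prod_insert (fun h => ha (Finset.mem_of_mem_erase h))]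
    ring

section Forms

variable {k : Type*} [Field k] {n d : ℕ}

/-- The forms `F` define the `n`-th symmetric power of `(z : w) ↦ (wᵈ : zᵈ + c wᵈ)`. -/
def IsSymPow (ζ c : k) (F : FormTuple k n d) : Prop :=
  ∀ z w : k, binaryForm (fun i => (F i : MvPolynomial (Fin (n + 1)) k))
    (C (w ^ d)) (C (z ^ d + c * w ^ d)) =
    ∏ j : Fin d, binaryForm X (C (ζ ^ (j : ℕ) * z)) (C w)

/-- The Jacobian matrix of `F` at `x`. -/
noncomputable def jacobianAt (F : FormTuple k n d) (x : Fin (n + 1) → k) :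
    Matrix (Fin (n + 1)) (Fin (n + 1)) k :=
  Matrix.of fun i j => eval x (pderiv j (F i : MvPolynomial (Fin (n + 1)) k))

lemma eval_jacobianDet (F : FormTuple k n d) (x : Fin (n + 1) → k) :
    eval x (jacobianDet F) = (jacobianAt F x).det := by
  rw [jacobianDet, RingHom.map_det]
  rfl

lemma eval_binaryForm_X (x : Fin (n + 1) → k) (a b : k) :
    eval x (binaryForm X (C a) (C b)) = binaryForm x a b := by
  simp [binaryForm]

lemma pderiv_binaryForm_X (i : Fin (n + 1)) (a b : k) :
    pderiv i (binaryForm (X : Fin (n + 1) → MvPolynomial (Fin (n + 1)) k) (C a) (C b)) =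
      C (a ^ (i : ℕ) * b ^ (n - i)) := by
  classical
  simp only [binaryForm, ← map_pow, ← map_mul, map_sum]
  rw [Finset.sum_eq_single i]
  · rw [mul_comm, pderiv_C_mul, pderiv_X_self, mul_one]
  · intro j _ hj
    rw [mul_comm, pderiv_C_mul, pderiv_X_of_ne hj, mul_zero]
  · simp

variable {ζ c : k} {F : FormTuple k n d}

lemma IsSymPow.binaryForm_evalTuple (hF : IsSymPow ζ c F) (x : Fin (n + 1) → k) (v : k × k) :
    binaryForm (evalTuple F x) (bicritical d c v).1 (bicritical d c v).2 =
      ∏ j : Fin d, binaryForm x (ζ ^ (j : ℕ) * v.1) v.2 := by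
  have h := congrArg (eval x) (hF v.1 v.2)
  simp only [map_prod, eval_binaryForm_X] at h
  rw [← h]
  simp [binaryForm, evalTuple, bicritical]

/-- Leibniz rule applied to the defining product: a binary form is linear in its coefficients, so
differentiating a factor in direction `h` replaces `x` by `h`. -/
lemma IsSymPow.binaryForm_jacobianAt (hF : IsSymPow ζ c F) (x h : Fin (n + 1) → k) (v : k × k) :
    binaryForm ((jacobianAt F x).mulVec h) (bicritical d c v).1 (bicritical d c v).2 =
      ∑ j : Fin d, binaryForm h (ζ ^ (j : ℕ) * v.1) v.2 *
        ∏ l ∈ Finset.univ.erase j, binaryForm x (ζ ^ (l : ℕ) * v.1) v.2 := by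
  have key : ∀ i, ∑ m, eval x (pderiv i (F m : MvPolynomial (Fin (n + 1)) k)) *
      ((v.2 ^ d) ^ (m : ℕ) * (v.1 ^ d + c * v.2 ^ d) ^ (n - m)) =
      ∑ j : Fin d, ((ζ ^ (j : ℕ) * v.1) ^ (i : ℕ) * v.2 ^ (n - i)) *
        ∏ l ∈ Finset.univ.erase j, binaryForm x (ζ ^ (l : ℕ) * v.1) v.2 := by
    intro i
    have h := congrArg (fun P => eval x (pderiv i P)) (hF v.1 v.2)
    simp only [derivation_prod, pderiv_binaryForm_X, map_sum, map_mul (eval x), eval_C,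
      map_prod, eval_binaryForm_X] at h
    rw [← h, binaryForm]
    simp only [map_sum, ← map_pow, ← map_mul]
    refine Finset.sum_congr rfl fun m _ => ?_
    rw [mul_comm _ (C _), pderiv_C_mul, map_mul, eval_C, mul_comm]
  simp only [binaryForm, Matrix.mulVec, dotProduct, jacobianAt, Matrix.of_apply, bicritical,
    Finset.sum_mul]
  rw [Finset.sum_comm]
  have h2 := fun i => congrArg (h i * ·) (key i)
  simp only [Finset.mul_sum] at h2
  rw [Finset.sum_comm (s := (Finset.univ : Finset (Fin d)))]
  refine Eq.trans ?_ ((Finset.sum_congr (Eq.refl Finset.univ) fun i _ => h2 i).trans ?_)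
  · refine Finset.sum_congr rfl fun i _ => Finset.sum_congr rfl fun m _ => ?_
    ring
  · refine Finset.sum_congr rfl fun i _ => Finset.sum_congr rfl fun j _ => ?_
    simp only [binaryForm]
    ring

lemma bicritical_surjective [IsAlgClosed k] (hd : 0 < d) (c : k) :
    Function.Surjective (bicritical d c) := by
  rintro ⟨a, b⟩
  obtain ⟨w, hw⟩ := IsAlgClosed.exists_pow_nat_eq a hd
  obtain ⟨z, hz⟩ := IsAlgClosed.exists_pow_nat_eq (b - c * a) hd
  exact ⟨(z, w), by simp [bicritical, hw, hz]⟩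

/-- The coefficient vector of the binary form with coefficient vector `x`, composed with
`z ↦ u z`. -/
def rotate (u : k) (x : Fin (n + 1) → k) : Fin (n + 1) → k := fun i => x i * u ^ (i : ℕ)

lemma eval_dehom_rotate (u : k) (x : Fin (n + 1) → k) (z : k) :
    (dehom (rotate u x)).eval z = binaryForm x (u * z) 1 := by
  rw [eval_dehom]
  simp [binaryForm, rotate, mul_pow, mul_assoc]

lemma rotate_ne_zero {u : k} (hu : u ≠ 0) {x : Fin (n + 1) → k} (hx : x ≠ 0) :
    rotate u x ≠ 0 := by
  obtain ⟨i, hi⟩ := Function.ne_iff.1 hx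
  exact Function.ne_iff.2 ⟨i, mul_ne_zero hi (pow_ne_zero _ hu)⟩

lemma dehom_rotate_ne_zero {u : k} (hu : u ≠ 0) {x : Fin (n + 1) → k} (hx : x ≠ 0) :
    dehom (rotate u x) ≠ 0 :=
  fun h => rotate_ne_zero hu hx ((dehom_eq_zero_iff _).1 h)

/-- At a common zero, a product of rotations of a nonzero polynomial would vanish. -/
lemma IsSymPow.noCommonZero [Infinite k] (hζ : ζ ≠ 0) (hF : IsSymPow ζ c F) :
    NoCommonZero F := by
  intro x hx h0
  have h : ∏ j : Fin d, dehom (rotate (ζ ^ (j : ℕ)) x) = 0 := Polynomial.funext fun z => by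
    rw [Polynomial.eval_prod, Polynomial.eval_zero]
    simp only [eval_dehom_rotate]
    have := hF.binaryForm_evalTuple x (z, 1)
    rw [← this, h0]
    simp [binaryForm]
  obtain ⟨j, -, hj⟩ := Finset.prod_eq_zero_iff.1 h
  exact dehom_rotate_ne_zero (pow_ne_zero _ hζ) hx hj

/-- The Jacobian is invertible at a form of full degree without zeros in common with
its rotations. -/
lemma IsSymPow.det_jacobianAt_ne_zero [IsAlgClosed k] [CharZero k] (hd : 0 < d) (hζ : ζ ≠ 0)
    (hF : IsSymPow ζ c F) {x : Fin (n + 1) → k} (hx : x (Fin.last n) ≠ 0)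
    (hroots : ∀ (z : k) (j : Fin d), (j : ℕ) ≠ 0 → binaryForm x z 1 = 0 →
      binaryForm x (ζ ^ (j : ℕ) * z) 1 ≠ 0) :
    (jacobianAt F x).det ≠ 0 := by
  intro hdet
  obtain ⟨h, h0, hker⟩ := Matrix.exists_mulVec_eq_zero_iff.2 hdet
  have hx0 : x ≠ 0 := fun h => hx (by rw [h]; rfl)
  let R : (Fin (n + 1) → k) → Fin d → Polynomial k := fun y j => dehom (rotate (ζ ^ (j : ℕ)) y)
  have hsum : ∑ j : Fin d, R h j * ∏ l ∈ Finset.univ.erase j, R x l = 0 :=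
    Polynomial.funext fun z => by
      have := hF.binaryForm_jacobianAt x h (z, 1)
      rw [hker] at this
      simp only [R, Polynomial.eval_finsetSum, Polynomial.eval_mul, Polynomial.eval_prod,
        eval_dehom_rotate, Polynomial.eval_zero]
      rw [← this]
      simp [binaryForm]
  let j₀ : Fin d := ⟨0, hd⟩
  have hR0 : ∀ y, R y j₀ = dehom y := fun y => by
    simp only [R, j₀, pow_zero]
    congr 1
    funext i
    simp [rotate]
  have hcop : IsCoprime (dehom x) (∏ l ∈ Finset.univ.erase j₀, R x l) := by
    refine IsCoprime.prod_right fun l hl => ?_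
    refine (Polynomial.isCoprime_iff_aeval_ne_zero_of_isAlgClosed (k := k) k _ _).2 fun z => ?_
    rw [Polynomial.coe_aeval_eq_eval, eval_dehom, eval_dehom_rotate, or_iff_not_imp_left, not_not]
    refine hroots z l fun hl0 => (Finset.mem_erase.1 hl).1 (Fin.ext hl0)
  -- Every summand with `j ≠ j₀` contains the factor `dehom x`, so `dehom x` divides the `j₀`
  -- summand too, and by coprimality it divides `dehom h`.
  have hdvd : dehom x ∣ dehom h := by
    refine hcop.dvd_of_dvd_mul_right ?_
    rw [← Finset.add_sum_erase _ _ (Finset.mem_univ j₀), hR0] at hsum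
    rw [eq_neg_of_add_eq_zero_left hsum, dvd_neg]
    refine Finset.dvd_sum fun j hj => dvd_mul_of_dvd_right ?_ _
    rw [← hR0]
    exact Finset.dvd_prod_of_mem _
      (Finset.mem_erase.2 ⟨(Finset.mem_erase.1 hj).1.symm, Finset.mem_univ _⟩)
  have hdeg : (dehom x).natDegree = n := by
    refine le_antisymm (natDegree_dehom_le x) (Polynomial.le_natDegree_of_ne_zero ?_)
    exact fun h0 => hx ((coeff_dehom x (Fin.last n)).symm.trans h0)
  have hh : dehom h ≠ 0 := fun h' => h0 ((dehom_eq_zero_iff h).1 h')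
  obtain ⟨g, hg⟩ := hdvd
  have hx' : dehom x ≠ 0 := fun h' => hx0 ((dehom_eq_zero_iff x).1 h')
  have hg0 : g ≠ 0 := fun h' => hh (by rw [hg, h', mul_zero])
  -- `dehom x` already has the maximal degree `n`, so the cofactor is constant.
  have hgdeg : g.natDegree = 0 := by
    have := natDegree_dehom_le h
    rw [hg, Polynomial.natDegree_mul hx' hg0, hdeg] at this
    omega
  obtain ⟨e, rfl⟩ := Polynomial.natDegree_eq_zero.1 hgdeg
  have he : h = e • x := by
    funext i
    rw [← coeff_dehom h, hg, Polynomial.coeff_mul_C, coeff_dehom]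
    simp [mul_comm]
  have hRe : ∀ j, R h j = Polynomial.C e * R x j := fun j => by
    refine Polynomial.funext fun z => ?_
    simp only [R, Polynomial.eval_mul, Polynomial.eval_C, eval_dehom_rotate, he, binaryForm_smul]
  have hprod : ∀ j : Fin d, R h j * ∏ l ∈ Finset.univ.erase j, R x l =
      Polynomial.C e * ∏ l, R x l := fun j => by
    rw [hRe, mul_assoc, Finset.mul_prod_erase _ _ (Finset.mem_univ j)]
  -- As in Euler's relation, the sum is `d * e` times the full product, which is nonzero in
  -- characteristic zero.
  simp only [hprod, Finset.sum_const, Finset.card_univ, Fintype.card_fin, nsmul_eq_mul] at hsum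
  have h1 : ((d : ℕ) : Polynomial k) ≠ 0 := Nat.cast_ne_zero.2 hd.ne'
  have h2 : ∏ l, R x l ≠ 0 :=
    Finset.prod_ne_zero_iff.2 fun l _ => dehom_rotate_ne_zero (pow_ne_zero _ hζ) hx0
  have h3 : Polynomial.C e ≠ 0 := hg0
  exact mul_ne_zero h1 (mul_ne_zero h3 h2) hsum

/-- The coordinate point `(1 : 0 : … : 0)`, that is `n` times the point `∞`, is critical. -/
lemma IsSymPow.det_jacobianAt_single [IsAlgClosed k] (hn : 1 ≤ n) (hd : 2 ≤ d)
    (hζ : IsPrimitiveRoot ζ d) (hF : IsSymPow ζ c F) :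
    (jacobianAt F (Pi.single 0 1)).det = 0 := by
  have : Infinite k := IsAlgClosed.instInfinite
  let i₁ : Fin (n + 1) := ⟨1, by omega⟩
  -- The form of n·∞ is `b ^ n`. The kernel vector `a * b ^ (n - 1)` moves one of the `n` points;
  -- its image carries the factor `∑ ζ ^ j`, which is zero because `d ≥ 2`.
  refine Matrix.exists_mulVec_eq_zero_iff.1 ⟨Pi.single i₁ 1, by simp, ?_⟩
  refine eq_zero_of_binaryForm_eq_zero fun a b => ?_
  obtain ⟨v, hv⟩ := bicritical_surjective (by omega : 0 < d) c (a, b)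
  have h := hF.binaryForm_jacobianAt (Pi.single 0 1) (Pi.single i₁ 1) v
  rw [hv] at h
  rw [h]
  have hsingle : ∀ (i : Fin (n + 1)) (a b : k),
      binaryForm (Pi.single i 1) a b = a ^ (i : ℕ) * b ^ (n - i) := fun i a b => by
    rw [binaryForm, Finset.sum_eq_single i]
    · simp
    · intro j _ hj
      simp [hj]
    · simp
  simp only [hsingle, i₁, Fin.val_zero, pow_zero, one_mul, pow_one, Nat.sub_zero,
    Finset.prod_const, Finset.card_erase_of_mem (Finset.mem_univ _), mul_assoc,
    ← Finset.sum_mul]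
  rw [← Finset.sum_range (fun j => ζ ^ j), hζ.geom_sum_eq_zero (by omega), zero_mul]

lemma prod_sub_rotate (hd : 0 < d) (hζ : IsPrimitiveRoot ζ d) (a b : k) :
    ∏ j : Fin d, (a - ζ ^ (j : ℕ) * b) = a ^ d - b ^ d := by
  classical
  rw [hζ.pow_sub_pow_eq_prod_sub_mul a b hd, ← Finset.prod_range (fun j => a - ζ ^ j * b)]
  refine Finset.prod_bij (fun j _ => ζ ^ j) ?_ ?_ ?_ (fun _ _ => rfl)
  · intro j _
    rw [Polynomial.mem_nthRootsFinset hd, ← pow_mul, mul_comm, pow_mul, hζ.pow_eq_one, one_pow]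
  · intro i hi j hj h
    exact hζ.pow_inj (Finset.mem_range.1 hi) (Finset.mem_range.1 hj) h
  · intro ξ hξ
    have : NeZero d := ⟨hd.ne'⟩
    obtain ⟨i, hi, h⟩ := hζ.eq_pow_of_pow_eq_one ((Polynomial.mem_nthRootsFinset hd _).1 hξ)
    exact ⟨i, Finset.mem_range.2 hi, h⟩

/-- The binary form with coefficient vector `x` is an `n`-th power of a linear form
vanishing at `v`. -/
def IsPureAt (x : Fin (n + 1) → k) (v : k × k) : Prop :=
  ∃ t : k, t ≠ 0 ∧ ∀ a b, binaryForm x a b = t * (v.1 * b - v.2 * a) ^ n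

/-- The symmetric power sends n·v to n·φ(v), because rotated linear forms multiply to a difference
of `d`-th powers. The sign `(-1) ^ n` appears because φ swaps the roles of the coordinates. -/
lemma IsSymPow.isPureAt_evalTuple [IsAlgClosed k] (hd : 0 < d)
    (hζ : IsPrimitiveRoot ζ d) (hF : IsSymPow ζ c F) {x : Fin (n + 1) → k} {v : k × k}
    (hx : IsPureAt x v) : IsPureAt (evalTuple F x) (bicritical d c v) := by
  obtain ⟨t, ht, h⟩ := hx
  refine ⟨t ^ d * (-1) ^ n, mul_ne_zero (pow_ne_zero _ ht) (pow_ne_zero _ (by simp)),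
    fun a b => ?_⟩
  obtain ⟨u, hu⟩ := bicritical_surjective hd c (a, b)
  have h1 := hF.binaryForm_evalTuple x u
  rw [hu] at h1
  have h2 : ∀ j : Fin d, binaryForm x (ζ ^ (j : ℕ) * u.1) u.2 =
      t * (v.1 * u.2 - ζ ^ (j : ℕ) * (v.2 * u.1)) ^ n := fun j => by rw [h]; ring
  simp only [h2, Finset.prod_mul_distrib, Finset.prod_pow, prod_sub_rotate hd hζ,
    Finset.prod_const, Finset.card_univ, Fintype.card_fin] at h1
  have ha : u.2 ^ d = a := congrArg Prod.fst hu
  have hb : u.1 ^ d + c * u.2 ^ d = b := congrArg Prod.snd hu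
  rw [h1, mul_assoc, ← mul_pow, ← ha, ← hb]
  simp only [bicritical]
  congr 2
  ring

lemma isPureAt_single : IsPureAt (Pi.single 0 1 : Fin (n + 1) → k) (1, 0) := by
  refine ⟨1, one_ne_zero, fun a b => ?_⟩
  rw [binaryForm, Finset.sum_eq_single 0]
  · simp
  · intro j _ hj
    simp [hj]
  · simp

lemma IsSymPow.isPureAt_iterate [IsAlgClosed k] (hd : 0 < d)
    (hζ : IsPrimitiveRoot ζ d) (hF : IsSymPow ζ c F) (s : ℕ) :
    IsPureAt ((evalTuple F)^[s] (Pi.single 0 1)) ((bicritical d c)^[s] (1, 0)) := by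
  induction s with
  | zero => exact isPureAt_single
  | succ s ih =>
    rw [Function.iterate_succ_apply', Function.iterate_succ_apply']
    exact hF.isPureAt_evalTuple hd hζ ih

lemma IsSymPow.exists_smul_eq_iterate_single [IsAlgClosed k] (hd : 0 < d)
    (hζ : IsPrimitiveRoot ζ d) (hF : IsSymPow ζ c F) {s : ℕ}
    (hc : ((bicritical d c)^[s] (1, 0)).2 = 0) :
    ∃ t : k, t • (Pi.single 0 1 : Fin (n + 1) → k) = (evalTuple F)^[s] (Pi.single 0 1) := by
  have : Infinite k := IsAlgClosed.instInfinite
  obtain ⟨t, -, h⟩ := hF.isPureAt_iterate (n := n) hd hζ s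
  obtain ⟨t', ht', h'⟩ := isPureAt_single (k := k) (n := n)
  refine ⟨t * ((bicritical d c)^[s] (1, 0)).1 ^ n / t', eq_of_binaryForm_eq fun a b => ?_⟩
  rw [binaryForm_smul, h, h', hc]
  simp only [one_mul, zero_mul, sub_zero, mul_pow]
  field_simp

/-! ### Zero sets of periodic forms -/

lemma IsSymPow.zeroSet_evalTuple_subset [IsAlgClosed k] (hd : 0 < d) (hζ : ζ ^ d = 1)
    (hF : IsSymPow ζ c F) (x : Fin (n + 1) → k) :
    zeroSet (evalTuple F x) ⊆ bicriticalMap d c '' zeroSet x := by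
  intro o ho
  obtain ⟨v, hv⟩ := bicritical_surjective hd c (ptRep o)
  have h := hF.binaryForm_evalTuple x v
  rw [hv, show binaryForm (evalTuple F x) (ptRep o).1 (ptRep o).2 = 0 from ho] at h
  -- A vanishing factor of the norm gives a zero of `x` at a rotation of `v`, which has the same
  -- image as `v`.
  obtain ⟨j, -, hj⟩ := Finset.prod_eq_zero_iff.1 h.symm
  have hu : bicritical d c (ζ ^ (j : ℕ) * v.1, v.2) = ptRep o := by
    rw [← hv]
    simp [bicritical, mul_pow, ← pow_mul, mul_comm _ d, pow_mul ζ, hζ]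
  have hu0 : (ζ ^ (j : ℕ) * v.1, v.2) ≠ (0 : k × k) := fun h0 => by
    rw [h0] at hu
    exact ptRep_ne_zero o (by rw [← hu]; simp [bicritical, hd.ne'])
  refine ⟨_, ptClass_mem_zeroSet hu0 hj, ?_⟩
  rw [← ptClass_bicritical d c hu0, hu, ptClass_ptRep]

lemma IsSymPow.zeroSet_iterate_subset [IsAlgClosed k] (hd : 0 < d) (hζ : ζ ^ d = 1)
    (hF : IsSymPow ζ c F) (x : Fin (n + 1) → k) (s : ℕ) :
    zeroSet ((evalTuple F)^[s] x) ⊆ (bicriticalMap d c)^[s] '' zeroSet x := by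
  induction s with
  | zero => simp
  | succ s ih =>
    rw [Function.iterate_succ_apply', Function.iterate_succ', Set.image_comp]
    exact (hF.zeroSet_evalTuple_subset hd hζ _).trans (Set.image_mono ih)

/-- A finite set contained in its image under `f` is mapped bijectively to itself. -/
lemma image_eq_and_injOn_of_subset_image {α : Type*} {f : α → α} {s : Finset α}
    (h : (s : Set α) ⊆ f '' s) : Set.MapsTo f s s ∧ Set.InjOn f s := by
  classical
  have h' : s ⊆ s.image f := by rw [← Finset.coe_subset, Finset.coe_image]; exact h
  have heq : s = s.image f := Finset.eq_of_subset_of_card_le h' Finset.card_image_le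
  refine ⟨fun a ha => ?_, Finset.card_image_iff.1 (by rw [← heq])⟩
  rw [heq]
  exact Finset.mem_coe.2 (Finset.mem_image_of_mem f ha)

lemma minimalPeriod_le_card_of_mapsTo {α : Type*} {f : α → α} {s : Finset α} {a : α}
    (hs : Set.MapsTo f s s) (ha : a ∈ s) : Function.minimalPeriod f a ≤ s.card := by
  have h := Finset.card_le_card_of_injOn (s := Finset.range (Function.minimalPeriod f a)) (t := s)
    (fun i => f^[i] a) (fun i _ => hs.iterate i ha)
    (by simpa using Function.iterate_injOn_Iio_minimalPeriod (f := f) (x := a))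
  rwa [Finset.card_range] at h

/-- If `∞` has period `p > n` under the map of the projective line, then a form whose class has
period `q` prime to `p` under its symmetric power is not critical. -/
lemma IsSymPow.det_jacobianAt_ne_zero_of_periodic [IsAlgClosed k] [CharZero k] (hd : 0 < d)
    (hζ : IsPrimitiveRoot ζ d) (hF : IsSymPow ζ c F) {p q : ℕ} (hp : p.Prime) (hq : q ≠ 0)
    (hpq : p.Coprime q) (hnp : n < p) (hc : ((bicritical d c)^[p] (1, 0)).2 = 0)
    {x : Fin (n + 1) → k} (hx : x ≠ 0) {t : k} (ht : t ≠ 0)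
    (hxt : t • x = (evalTuple F)^[q] x) :
    (jacobianAt F x).det ≠ 0 := by
  obtain ⟨s, hs, hcard⟩ := exists_finset_card_le_zeroSet hx
  have hsub : (s : Set (Option k)) ⊆ (bicriticalMap d c)^[q] '' s := by
    have h := hF.zeroSet_iterate_subset hd hζ.pow_eq_one x q
    rwa [← hxt, zeroSet_smul ht, ← hs] at h
  obtain ⟨hmaps, hinj⟩ := image_eq_and_injOn_of_subset_image hsub
  have hinj' : Set.InjOn (bicriticalMap d c) s := by
    obtain ⟨r, rfl⟩ : ∃ r, q = r + 1 := ⟨q - 1, by omega⟩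
    intro a ha b hb hab
    refine hinj ha hb ?_
    rw [Function.iterate_succ_apply, Function.iterate_succ_apply, hab]
  have hper := minimalPeriod_bicriticalMap_none hd hp hc
  have hnot : ∀ o, Function.minimalPeriod (bicriticalMap d c) o = p → o ∉ zeroSet x := by
    intro o ho hmem
    rw [← hs, Finset.mem_coe] at hmem
    -- The period under the `q`-th iterate is `p / gcd p q = p`, more than the at most `n` points
    -- available.
    have h := minimalPeriod_le_card_of_mapsTo hmaps hmem
    rw [Function.minimalPeriod_iterate_eq_div_gcd hq, ho, hpq.gcd_eq_one, Nat.div_one] at h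
    omega
  have hnone := hnot none hper
  have hzero := hnot (some 0) (by
    rw [← bicriticalMap_none hd c, Function.minimalPeriod_apply, hper]
    exact Function.minimalPeriod_pos_iff_mem_periodicPts.1 (by rw [hper]; exact hp.pos))
  have hζ0 : ζ ≠ 0 := hζ.ne_zero hd.ne'
  refine hF.det_jacobianAt_ne_zero hd hζ0 (fun h => hnone (none_mem_zeroSet.2 h)) ?_
  intro z j hj h1 h2
  have hz : z ≠ 0 := by
    rintro rfl
    exact hzero (some_mem_zeroSet.2 h1)
  -- `z` and `ζ ^ j * z` have the same image, so injectivity on the zero set forces `ζ ^ j = 1`.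
  have h := hinj' (x₁ := some z) (x₂ := some (ζ ^ (j : ℕ) * z)) (by rw [hs]; exact h1)
    (by rw [hs]; exact h2) (by
      simp [bicriticalMap, bicritical, ptRep, mul_pow, ← pow_mul, mul_comm _ d, pow_mul ζ,
        hζ.pow_eq_one])
  have h' : ζ ^ (j : ℕ) = 1 := by
    have := Option.some.inj h
    exact mul_right_cancel₀ hz (by rw [one_mul]; exact this.symm)
  exact hj (Nat.eq_zero_of_dvd_of_lt (hζ.dvd_of_pow_eq_one _ h') j.2)

end Forms

/-! ### Passage to projective space and conclusion -/

section Projective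

variable {k : Type*} [Field k] {n d : ℕ}

lemma NoCommonZero.iterate_ne_zero {F : FormTuple k n d} (hF : NoCommonZero F)
    {x : Fin (n + 1) → k} (hx : x ≠ 0) (s : ℕ) : (evalTuple F)^[s] x ≠ 0 := by
  induction s with
  | zero => exact hx
  | succ s ih =>
    rw [Function.iterate_succ_apply']
    exact hF _ ih

lemma EndP.iterate_toMap_mk (f : EndP k n d) (F : FormTuple k n d) (hF : F ≠ 0)
    (hf : f.1 = Projectivization.mk k F hF) (hF0 : NoCommonZero F) (x : Fin (n + 1) → k)
    (hx : x ≠ 0) (s : ℕ) :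
    f.toMap^[s] (Projectivization.mk k x hx) =
      Projectivization.mk k ((evalTuple F)^[s] x) (hF0.iterate_ne_zero hx s) := by
  induction s with
  | zero => rfl
  | succ s ih =>
    simp only [Function.iterate_succ_apply', ih]
    exact f.toMap_mk F hF hf _ _ _

/-- Periodicity may be tested on representatives. -/
lemma EndP.isPeriodicPt_mk_iff (f : EndP k n d) (F : FormTuple k n d) (hF : F ≠ 0)
    (hf : f.1 = Projectivization.mk k F hF) (hF0 : NoCommonZero F) (x : Fin (n + 1) → k)
    (hx : x ≠ 0) (s : ℕ) :
    Function.IsPeriodicPt f.toMap s (Projectivization.mk k x hx) ↔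
      ∃ t : k, t • x = (evalTuple F)^[s] x := by
  rw [Function.IsPeriodicPt, Function.IsFixedPt, f.iterate_toMap_mk F hF hf hF0,
    Projectivization.mk_eq_mk_iff']

/-- Some endomorphism has a critical point of period `p` but none of period dividing `q`. -/
lemma exists_mem_Y_notMem_Y (k : Type*) [Field k] [IsAlgClosed k] [CharZero k]
    {n d : ℕ} (hn : 1 ≤ n) (hd : 2 ≤ d) {p q : ℕ} (hp : p.Prime) (hq : q ≠ 0)
    (hpq : p.Coprime q) (hnp : n < p) :
    ∃ f, f ∈ Y k n d p ∧ f ∉ Y k n d q := by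
  have : Infinite k := IsAlgClosed.instInfinite
  have hd0 : 0 < d := by omega
  have : NeZero (d : k) := ⟨Nat.cast_ne_zero.2 hd0.ne'⟩
  obtain ⟨ζ, hζ⟩ := HasEnoughRootsOfUnity.exists_primitiveRoot k d
  obtain ⟨c, hc⟩ := exists_bicritical_periodic (k := k) hd0 hp.two_le
  obtain ⟨F, hF⟩ : ∃ F : FormTuple k n d, IsSymPow ζ c F := exists_symPowForms hd0 hζ n c
  have hF0 : NoCommonZero F := hF.noCommonZero (hζ.ne_zero hd0.ne')
  have hne : F ≠ 0 := by
    rintro rfl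
    refine hF0 (Pi.single 0 1) (by simp) ?_
    funext i
    simp [evalTuple]
  let f : EndP k n d := ⟨Projectivization.mk k F hne, (noCommonZero_rep_iff F hne).2 hF0⟩
  refine ⟨f, ⟨Projectivization.mk k (Pi.single 0 1) (by simp), ?_, ?_⟩, ?_⟩
  · rw [f.isCritical_mk F hne rfl, eval_jacobianDet]
    exact hF.det_jacobianAt_single hn hd hζ
  · rw [f.isPeriodicPt_mk_iff F hne rfl hF0]
    exact hF.exists_smul_eq_iterate_single hd0 hζ hc
  · rintro ⟨P, hcrit, hper⟩
    induction P using Projectivization.ind with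
    | h x hx =>
    rw [f.isCritical_mk F hne rfl, eval_jacobianDet] at hcrit
    obtain ⟨t, ht⟩ := (f.isPeriodicPt_mk_iff F hne rfl hF0 x hx q).1 hper
    have ht0 : t ≠ 0 := by
      rintro rfl
      exact hF0.iterate_ne_zero hx q (by rw [← ht, zero_smul])
    exact hF.det_jacobianAt_ne_zero_of_periodic hd0 hζ hp hq hpq hnp hc hx ht0 ht hcrit

end Projective

end ProjEnd

theorem lemma2 (k : Type*) [Field k] [IsAlgClosed k] [CharZero k]
    (n d : ℕ) (hn : 1 ≤ n) (hd : 2 ≤ d)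
    (p q : ℕ) (hp : p.Prime) (hq : q.Prime) (hnp : n < p) (hnq : n < q) (hpq : p ≠ q) :
    ProjEnd.Y k n d p ≠ ProjEnd.Y k n d q := by
  obtain ⟨f, hfp, hfq⟩ := ProjEnd.exists_mem_Y_notMem_Y k hn hd hp hq.ne_zero
    ((Nat.coprime_primes hp hq).2 hpq) hnp
  exact fun h => hfq (h ▸ hfp)
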